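/- For a complex $n\times n$ matrix $A$ and $1<p<\infty$ let $\|A\|_p=(\mathrm{Tr}\,|A|^p)^{1/p}$, with $|A|=(A^*A)^{1/2}$, denote the Schatten $p$-norm. Let $1<p\le 2$, $\mu\ge 1$ and $\lambda=\frac{1}{1+\mu^4}$. Then for all $n\ge 1$ and all complex $n\times n$ matrices $A,B$, $$\Big(\lambda\|A+\mu^2B\|_p^p+(1-\lambda)\|A-\mu^{-2}B\|_p^p\Big)^{2/p}\ \ge\ \|A\|_p^2+C(p-1)\|B\|_p^2,$$ where $C=C(\mu)=\frac13\mu^{-4}$ if $1<p\le\frac43$, and $C=C(\mu)=\frac13\mu^{8-16/p}$ if $\frac43<p\le 2$. -/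

import Mathlib

/-- The singular values of a complex `n × n` matrix `A`, repeated with multiplicity: the square
roots of the eigenvalues of the positive semidefinite matrix `Aᴴ * A`. -/
noncomputable def matSingularValue {n : ℕ} (A : Matrix (Fin n) (Fin n) ℂ) (i : Fin n) : ℝ :=
  Real.sqrt ((Matrix.isHermitian_conjTranspose_mul_self A).eigenvalues i)

/-- The Schatten `p`-norm `‖A‖_p = (Tr |A|^p)^(1/p) = (∑ i, s_i(A)^p)^(1/p)` of a complex `n × n`
matrix, for a finite exponent `p`. -/
noncomputable def schattenNorm {n : ℕ} (p : ℝ) (A : Matrix (Fin n) (Fin n) ℂ) : ℝ :=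
  (∑ i, matSingularValue A i ^ p) ^ (1 / p)

/-- The constant `C(μ)` (it also depends on the exponent `p`): `μ⁻⁴ / 3` for `p ≤ 4/3` and
`μ ^ (8 - 16 / p) / 3` for `p > 4/3`. -/
noncomputable def asymConvexityConst (p μ : ℝ) : ℝ :=
  if p ≤ 4 / 3 then (1 / 3) * μ ^ (-4 : ℝ) else (1 / 3) * μ ^ (8 - 16 / p)

/-! Everything rests on strong convexity of `|t| ^ p`: its Bregman divergence times `|x| ^ (2 - p) +
|z| ^ (2 - p)` dominates `p (p - 1) / 2 * (z - x) ^ 2` (`abs_rpow_bregman_mul_ge`). For Hermitian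
`X` and `Z = X + ξ Y`, let `W` be the unitary between their eigenbases. The trace divergence is the
average of scalar divergences with the doubly stochastic weights `‖W i j‖ ^ 2`, and `ξ Y` has
entries `(z j - x i) * W i j` in the mixed basis. Duality, Cauchy–Schwarz and Hölder turn the scalar
bound into one for Schatten norms (`absPowTrace_strongConvex`); Hermitian dilation removes
self-adjointness. At the points `μ ^ 2` and `-μ ^ (-2)` the first-order terms cancel under the
weights `λ`, `1 - λ`. Cauchy–Schwarz, Jensen and a comparison of `p`-th powers with squares finish
(`sq_add_mul_sq_le_of_two_points`). -/

/-! ### Scalar strong convexity -/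

/-- On `(0, M]` the slopes of the concave function `t ↦ t ^ s` are at least its derivative
at `M`. -/
theorem rpow_sub_rpow_ge_of_le {s a b M : ℝ} (hs0 : 0 ≤ s) (hs1 : s ≤ 1) (ha : 0 ≤ a) (hab : a ≤ b)
    (hb : 0 < b) (hbM : b ≤ M) : s * M ^ (s - 1) * (b - a) ≤ b ^ s - a ^ s := by
  have h1 : a ^ s ≤ b ^ s + s * b ^ (s - 1) * (a - b) := by
    -- The tangent line at `b` lies above the concave power: Bernoulli's inequality after scaling by
    -- `b`.
    have h := rpow_one_add_le_one_add_mul_self (s := a / b - 1)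
      (by have : 0 ≤ a / b := by positivity
          linarith) hs0 hs1
    have h2 : a ^ s = b ^ s * (1 + (a / b - 1)) ^ s := by
      rw [← Real.mul_rpow hb.le (by rw [add_sub_cancel]; positivity)]
      congr 1
      field_simp
      ring
    rw [h2, Real.rpow_sub_one hb.ne']
    calc b ^ s * (1 + (a / b - 1)) ^ s ≤ b ^ s * (1 + s * (a / b - 1)) := by gcongr
      _ = _ := by field_simp
  have h2 : M ^ (s - 1) ≤ b ^ (s - 1) := Real.rpow_le_rpow_of_nonpos hb hbM (by linarith)
  have h3 : s * M ^ (s - 1) * (b - a) ≤ s * b ^ (s - 1) * (b - a) := by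
    have : 0 ≤ b - a := by linarith
    gcongr
  linarith

/-- Strong convexity of `t ↦ t ^ p` on `[0, M]`. -/
theorem rpow_bregman_ge_of_nonneg {p x z M : ℝ} (hp1 : 1 < p) (hp2 : p ≤ 2) (hx : 0 < x)
    (hz : 0 ≤ z) (hxM : x ≤ M) (hzM : z ≤ M) :
    p * (p - 1) / 2 * M ^ (p - 2) * (z - x) ^ 2 ≤ z ^ p - x ^ p - p * x ^ (p - 1) * (z - x) := by
  set k : ℝ := p * (p - 1) / 2 * M ^ (p - 2) with hk
  -- `G` vanishes at `x` and its derivative has the sign of `t - x`, so `x` is a minimum.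
  set G : ℝ → ℝ := fun t => t ^ p - x ^ p - p * x ^ (p - 1) * (t - x) - k * (t - x) ^ 2 with hG
  have hd : ∀ t, 0 < t → HasDerivAt G (p * t ^ (p - 1) - p * x ^ (p - 1) - 2 * k * (t - x)) t := by
    intro t ht
    have h1 := Real.hasDerivAt_rpow_const (x := t) (p := p) (Or.inl ht.ne')
    have h2 := ((hasDerivAt_id t).sub_const x)
    have h3 := ((h1.sub_const (x ^ p)).sub (h2.const_mul (p * x ^ (p - 1)))).sub
      ((h2.pow 2).const_mul k)
    refine h3.congr_deriv ?_
    simp only [id]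
    ring
  have hcont : Continuous G := by
    have : Continuous fun t : ℝ => t ^ p := Real.continuous_rpow_const (by linarith)
    fun_prop
  have h0 : G x = 0 := by simp [hG]
  have key : ∀ a b, 0 ≤ a → a ≤ b → 0 < b → b ≤ M →
      2 * k * (b - a) ≤ p * b ^ (p - 1) - p * a ^ (p - 1) := by
    intro a b ha hab hb hbM
    have h := rpow_sub_rpow_ge_of_le (s := p - 1) (by linarith) (by linarith) ha hab hb hbM
    have e : p - 1 - 1 = p - 2 := by ring
    rw [e] at h
    have := mul_le_mul_of_nonneg_left h (by linarith : 0 ≤ p)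
    rw [hk]
    linarith
  have hGz : 0 ≤ G z := by
    rw [← h0]
    rcases le_total x z with h | h
    · have hm : MonotoneOn G (Set.Icc x z) := by
        refine monotoneOn_of_deriv_nonneg (convex_Icc x z) hcont.continuousOn ?_ ?_
        · intro t ht
          rw [interior_Icc] at ht
          exact (hd t (hx.trans ht.1)).differentiableAt.differentiableWithinAt
        · intro t ht
          rw [interior_Icc] at ht
          rw [(hd t (hx.trans ht.1)).deriv]
          have := key x t hx.le ht.1.le (hx.trans ht.1) (ht.2.le.trans hzM)
          linarith
      exact hm ⟨le_rfl, h⟩ ⟨h, le_rfl⟩ h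
    · have hm : AntitoneOn G (Set.Icc z x) := by
        refine antitoneOn_of_deriv_nonpos (convex_Icc z x) hcont.continuousOn ?_ ?_
        · intro t ht
          rw [interior_Icc] at ht
          exact (hd t (hz.trans_lt ht.1)).differentiableAt.differentiableWithinAt
        · intro t ht
          rw [interior_Icc] at ht
          rw [(hd t (hz.trans_lt ht.1)).deriv]
          have := key t x (hz.trans ht.1.le) ht.2.le hx hxM
          linarith
      exact hm ⟨le_rfl, h⟩ ⟨h, le_rfl⟩ h
  simp only [hG] at hGz
  linarith

theorem rpow_mul_rpow_two_sub {p x : ℝ} (hx : 0 ≤ x) : x ^ p * x ^ (2 - p) = x ^ 2 := by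
  rw [← Real.rpow_add' hx (by norm_num), ← Real.rpow_natCast]
  norm_num

/-- For equal signs the weight bounds `max x z ^ (2 - p)`; for opposite signs the product expands
into nonnegative terms. A sum is used as weight, rather than a maximum, so that rows and columns
separate in the matrix argument. -/
theorem rpow_bregman_mul_ge_of_pos {p x z : ℝ} (hp1 : 1 < p) (hp2 : p ≤ 2) (hx : 0 < x) :
    p * (p - 1) / 2 * (z - x) ^ 2 ≤
      (|z| ^ p - x ^ p - p * x ^ (p - 1) * (z - x)) * (x ^ (2 - p) + |z| ^ (2 - p)) := by
  rcases le_or_gt 0 z with hz | hz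
  · rw [abs_of_nonneg hz]
    have hM : 0 < max x z := hx.trans_le (le_max_left _ _)
    have h := rpow_bregman_ge_of_nonneg hp1 hp2 hx hz (le_max_left x z) (le_max_right x z)
    have h1 : max x z ^ (2 - p) ≤ x ^ (2 - p) + z ^ (2 - p) := by
      rcases max_cases x z with ⟨h, -⟩ | ⟨h, -⟩ <;> rw [h]
      · have : 0 ≤ z ^ (2 - p) := by positivity
        linarith
      · have : 0 ≤ x ^ (2 - p) := by positivity
        linarith
    have h2 : max x z ^ (p - 2) * max x z ^ (2 - p) = 1 := by
      rw [← Real.rpow_add hM]; simp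
    have h3 : 0 ≤ p * (p - 1) / 2 * max x z ^ (p - 2) * (z - x) ^ 2 := by
      have : 0 ≤ p - 1 := by linarith
      positivity
    calc p * (p - 1) / 2 * (z - x) ^ 2
        = p * (p - 1) / 2 * max x z ^ (p - 2) * (z - x) ^ 2 * max x z ^ (2 - p) := by
          linear_combination (-(p * (p - 1) / 2 * (z - x) ^ 2)) * h2
      _ ≤ _ := mul_le_mul h h1 (by positivity) (h3.trans h)
  · obtain ⟨y, rfl⟩ : ∃ y, z = -y := ⟨-z, by ring⟩
    have hy : 0 < y := by linarith
    rw [abs_neg, abs_of_pos hy]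
    have e1 := rpow_mul_rpow_two_sub (p := p) hx.le
    have e2 := rpow_mul_rpow_two_sub (p := p) hy.le
    have e3 : x ^ (p - 1) * x = x ^ p := by
      rw [Real.rpow_sub_one hx.ne']; field_simp
    have e4 : x ^ (p - 1) * x ^ (2 - p) = x := by
      rw [← Real.rpow_add hx]; norm_num
    have a1 : 0 < x ^ (p - 1) := by positivity
    have a2 : 0 < x ^ (2 - p) := by positivity
    have a3 : 0 < y ^ (2 - p) := by positivity
    have a4 : 0 < y ^ p := by positivity
    have a5 : 0 < x ^ p := by positivity
    have hq : 0 ≤ p - 1 := by linarith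
    have b1 : 0 ≤ y ^ p * x ^ (2 - p) := by positivity
    have b2 : 0 ≤ (p - 1) * x ^ p * y ^ (2 - p) := by positivity
    have b3 : 0 ≤ p * x ^ (p - 1) * y * y ^ (2 - p) := by positivity
    have e5 : (y ^ p - x ^ p - p * x ^ (p - 1) * (-y - x)) * (x ^ (2 - p) + y ^ (2 - p)) =
        y ^ 2 + p * x * y + (p - 1) * x ^ 2 + y ^ p * x ^ (2 - p) + (p - 1) * x ^ p * y ^ (2 - p) +
          p * x ^ (p - 1) * y * y ^ (2 - p) := by
      linear_combination e2 + (p - 1) * e1 + p * y * e4 +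
        p * (x ^ (2 - p) + y ^ (2 - p)) * e3
    rw [e5]
    have hxy : 0 < x * y := by positivity
    have c1 : p * (p - 1) / 2 ≤ p - 1 := by nlinarith
    have c2 : p * (p - 1) / 2 * (-y - x) ^ 2 ≤ (p - 1) * (-y - x) ^ 2 := by gcongr
    nlinarith [mul_nonneg (by linarith : 0 ≤ 2 - p) hxy.le,
      mul_nonneg (by linarith : 0 ≤ 2 - p) (sq_nonneg y)]

/-- Strong convexity of `t ↦ |t| ^ p` on the real line, for `1 < p ≤ 2`. -/
theorem abs_rpow_bregman_mul_ge {p : ℝ} (hp1 : 1 < p) (hp2 : p ≤ 2) (x z : ℝ) :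
    p * (p - 1) / 2 * (z - x) ^ 2 ≤
      (|z| ^ p - |x| ^ p - p * (Real.sign x * |x| ^ (p - 1)) * (z - x)) *
        (|x| ^ (2 - p) + |z| ^ (2 - p)) := by
  rcases lt_trichotomy x 0 with hx | rfl | hx
  · have h := rpow_bregman_mul_ge_of_pos (z := -z) hp1 hp2 (neg_pos.2 hx)
    rw [Real.sign_of_neg hx, abs_of_neg hx]
    rw [abs_neg] at h
    convert h using 1 <;> ring
  · have h0 : (0 : ℝ) ^ p = 0 := Real.zero_rpow (by linarith)
    have h1 := rpow_mul_rpow_two_sub (p := p) (abs_nonneg z)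
    rw [sq_abs] at h1
    -- At `p = 2` the factor `|0| ^ (2 - p)` is `1`, so only its sign is used.
    have h2 : 0 ≤ |z| ^ p * |0| ^ (2 - p) := by positivity
    simp only [abs_zero, Real.sign_zero, h0] at *
    nlinarith [mul_nonneg (mul_nonneg (by linarith : 0 ≤ 2 - p) (by linarith : 0 ≤ p + 1)) (sq_nonneg z)]
  · have h := rpow_bregman_mul_ge_of_pos (z := z) hp1 hp2 hx
    rw [Real.sign_of_pos hx, abs_of_pos hx]
    convert h using 1; ring

/-! ### Hölder and duality bounds -/

/-- Hölder's inequality against a doubly stochastic matrix. -/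
theorem doublyStochastic_holder {ι κ : Type*} [Fintype ι] [Fintype κ] {D : ι → κ → ℝ}
    (hD : ∀ i j, 0 ≤ D i j) (hrow : ∀ i, ∑ j, D i j = 1) (hcol : ∀ j, ∑ i, D i j = 1)
    {a : ι → ℝ} {b : κ → ℝ} (ha : ∀ i, 0 ≤ a i) (hb : ∀ j, 0 ≤ b j) {s t : ℝ} (hs : 0 ≤ s)
    (ht : 0 < t) (hst : s + t = 1) :
    ∑ i, ∑ j, D i j * (a i ^ s * b j ^ t) ≤ (∑ i, a i) ^ s * (∑ j, b j) ^ t := by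
  rcases hs.eq_or_lt with rfl | hs
  · have : t = 1 := by linarith
    subst this
    simp only [Real.rpow_zero, Real.rpow_one, one_mul]
    rw [Finset.sum_comm]
    simp [← Finset.sum_mul, hcol]
  have hA0 : 0 ≤ ∑ i, a i := Finset.sum_nonneg fun i _ => ha i
  have hB0 : 0 ≤ ∑ j, b j := Finset.sum_nonneg fun i _ => hb i
  rcases hA0.eq_or_lt with hA | hA
  · have : ∀ i, a i = 0 := fun i =>
      (Finset.sum_eq_zero_iff_of_nonneg fun i _ => ha i).1 hA.symm i (Finset.mem_univ i)
    simp [this, Real.zero_rpow hs.ne']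
  rcases hB0.eq_or_lt with hB | hB
  · have : ∀ i, b i = 0 := fun i =>
      (Finset.sum_eq_zero_iff_of_nonneg fun i _ => hb i).1 hB.symm i (Finset.mem_univ i)
    simp [this, Real.zero_rpow ht.ne']
  set SA := ∑ i, a i with hSA
  set SB := ∑ j, b j with hSB
  -- Weighted AM-GM after normalizing both sums to one; row and column sums then give `s + t = 1`.
  have key : ∀ i j, D i j * (a i ^ s * b j ^ t) ≤
      SA ^ s * SB ^ t * (s / SA * (D i j * a i) + t / SB * (D i j * b j)) := by
    intro i j
    have h := Real.geom_mean_le_arith_mean2_weighted hs.le ht.le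
      (div_nonneg (ha i) hA.le) (div_nonneg (hb j) hB.le) hst
    rw [Real.div_rpow (ha i) hA.le, Real.div_rpow (hb j) hB.le] at h
    have hAs : 0 < SA ^ s := by positivity
    have hBt : 0 < SB ^ t := by positivity
    calc D i j * (a i ^ s * b j ^ t)
        = D i j * (SA ^ s * SB ^ t) * (a i ^ s / SA ^ s * (b j ^ t / SB ^ t)) := by
          field_simp
      _ ≤ D i j * (SA ^ s * SB ^ t) * (s * (a i / SA) + t * (b j / SB)) := by
          have := hD i j
          gcongr
      _ = _ := by ring
  calc _ ≤ ∑ i, ∑ j, SA ^ s * SB ^ t * (s / SA * (D i j * a i) + t / SB * (D i j * b j)) := by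
        exact Finset.sum_le_sum fun i _ => Finset.sum_le_sum fun j _ => key i j
    _ = SA ^ s * SB ^ t * (s / SA * (∑ i, ∑ j, D i j * a i) +
          t / SB * (∑ i, ∑ j, D i j * b j)) := by
        simp only [← Finset.mul_sum, Finset.sum_add_distrib]
    _ = SA ^ s * SB ^ t := by
        rw [Finset.sum_comm (f := fun i j => D i j * b j)]
        simp only [← Finset.sum_mul, hrow, hcol, one_mul]
        rw [← hSA, ← hSB, div_mul_cancel₀ _ hA.ne', div_mul_cancel₀ _ hB.ne', hst, mul_one]
open Matrix

section Unitary
variable {ι : Type*} [Fintype ι] [DecidableEq ι]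

omit [DecidableEq ι] in
theorem sum_norm_sq_row (M : Matrix ι ι ℂ) (i : ι) :
    ((∑ j, ‖M i j‖ ^ 2 : ℝ) : ℂ) = (M * Mᴴ) i i := by
  simp [Matrix.mul_apply, Matrix.conjTranspose_apply, Complex.mul_conj']

omit [DecidableEq ι] in
theorem sum_norm_sq_col (M : Matrix ι ι ℂ) (j : ι) :
    ((∑ i, ‖M i j‖ ^ 2 : ℝ) : ℂ) = (Mᴴ * M) j j := by
  simp [Matrix.mul_apply, Matrix.conjTranspose_apply, Complex.conj_mul']

theorem sum_norm_sq_row_unitary {W : Matrix ι ι ℂ} (hW : W ∈ unitaryGroup ι ℂ) (i : ι) :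
    ∑ j, ‖W i j‖ ^ 2 = 1 := by
  have h := sum_norm_sq_row W i
  rw [← star_eq_conjTranspose, mem_unitaryGroup_iff.1 hW] at h
  exact Complex.ofReal_injective (by rw [h]; simp)

theorem sum_norm_sq_col_unitary {W : Matrix ι ι ℂ} (hW : W ∈ unitaryGroup ι ℂ) (j : ι) :
    ∑ i, ‖W i j‖ ^ 2 = 1 := by
  have h := sum_norm_sq_col W j
  rw [← star_eq_conjTranspose, mem_unitaryGroup_iff'.1 hW] at h
  exact Complex.ofReal_injective (by rw [h]; simp)

/-- The matrix with singular values `|κ k|` and singular vectors the columns of `R` and `S`. -/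
noncomputable def svdMatrix (R S : Matrix ι ι ℂ) (κ : ι → ℝ) : Matrix ι ι ℂ :=
  R * diagonal (fun k => (κ k : ℂ)) * Sᴴ

theorem svdMatrix_conjTranspose (R S : Matrix ι ι ℂ) (κ : ι → ℝ) :
    (svdMatrix R S κ)ᴴ = svdMatrix S R κ := by
  simp only [svdMatrix, conjTranspose_mul, diagonal_conjTranspose, conjTranspose_conjTranspose,
    ← mul_assoc]
  congr 3
  ext k
  simp

theorem svdMatrix_mul_svdMatrix {R S T : Matrix ι ι ℂ} (hS : S ∈ unitaryGroup ι ℂ) (κ η : ι → ℝ) :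
    svdMatrix R S κ * svdMatrix S T η = svdMatrix R T (κ * η) := by
  have h : Sᴴ * S = 1 := mem_unitaryGroup_iff'.1 hS
  calc svdMatrix R S κ * svdMatrix S T η
      = R * diagonal (fun k => (κ k : ℂ)) * (Sᴴ * S) * diagonal (fun k => (η k : ℂ)) * Tᴴ := by
        simp only [svdMatrix, mul_assoc]
    _ = _ := by
        rw [h, mul_one, mul_assoc R, diagonal_mul_diagonal]
        simp [svdMatrix]

theorem svdMatrix_self_apply_self (R : Matrix ι ι ℂ) (κ : ι → ℝ) (i : ι) :
    svdMatrix R R κ i i = ((∑ k, ‖R i k‖ ^ 2 * κ k : ℝ) : ℂ) := by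
  rw [svdMatrix, Matrix.mul_apply]
  push_cast
  refine Finset.sum_congr rfl fun k _ => ?_
  rw [mul_diagonal, conjTranspose_apply, ← Complex.mul_conj', starRingEnd_apply]
  ring

theorem sum_norm_sq_svdMatrix_row {R S : Matrix ι ι ℂ} (hS : S ∈ unitaryGroup ι ℂ) (κ : ι → ℝ)
    (i : ι) : ∑ j, ‖svdMatrix R S κ i j‖ ^ 2 = ∑ k, ‖R i k‖ ^ 2 * κ k ^ 2 := by
  have h := sum_norm_sq_row (svdMatrix R S κ) i
  rw [svdMatrix_conjTranspose, svdMatrix_mul_svdMatrix hS, svdMatrix_self_apply_self] at h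
  simpa [sq] using Complex.ofReal_injective h

theorem sum_norm_sq_svdMatrix_col {R S : Matrix ι ι ℂ} (hR : R ∈ unitaryGroup ι ℂ) (κ : ι → ℝ)
    (j : ι) : ∑ i, ‖svdMatrix R S κ i j‖ ^ 2 = ∑ k, ‖S j k‖ ^ 2 * κ k ^ 2 := by
  have h := sum_norm_sq_col (svdMatrix R S κ) j
  rw [svdMatrix_conjTranspose, svdMatrix_mul_svdMatrix hR, svdMatrix_self_apply_self] at h
  simpa [sq] using Complex.ofReal_injective h

theorem sum_star_svdMatrix_mul_svdMatrix {R S : Matrix ι ι ℂ} (hR : R ∈ unitaryGroup ι ℂ)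
    (hS : S ∈ unitaryGroup ι ℂ) (η κ : ι → ℝ) :
    ∑ i, ∑ j, star (svdMatrix R S η i j) * svdMatrix R S κ i j = ((∑ k, η k * κ k : ℝ) : ℂ) := by
  have h : ((svdMatrix R S η)ᴴ * svdMatrix R S κ).trace = ((∑ k, η k * κ k : ℝ) : ℂ) := by
    rw [svdMatrix_conjTranspose, svdMatrix_mul_svdMatrix hR, trace]
    simp only [diag_apply, svdMatrix_self_apply_self]
    rw [← Complex.ofReal_sum, Finset.sum_comm]
    simp only [← Finset.sum_mul, sum_norm_sq_col_unitary hS, one_mul, Pi.mul_apply]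
  rw [← h, trace, Finset.sum_comm]
  simp [Matrix.mul_apply, conjTranspose_apply]

/-- Cauchy–Schwarz and Hölder: a weighted Hilbert–Schmidt bound for a Schatten norm. -/
theorem svdMatrix_weighted_bound {R S : Matrix ι ι ℂ} (hR : R ∈ unitaryGroup ι ℂ)
    (hS : S ∈ unitaryGroup ι ℂ) {p : ℝ} (hp1 : 1 < p) (hp2 : p ≤ 2) (x z h : ι → ℝ)
    {q : ι → ι → ℝ} (hq0 : ∀ i j, 0 ≤ q i j)
    (hq : ∀ i j, ‖svdMatrix R S h i j‖ ^ 2 ≤ q i j * (|x i| ^ (2 - p) + |z j| ^ (2 - p))) :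
    (∑ k, |h k| ^ p) ^ (2 / p) ≤ (∑ i, ∑ j, q i j) *
      ((∑ i, |x i| ^ p) ^ ((2 - p) / p) + (∑ j, |z j| ^ p) ^ ((2 - p) / p)) := by
  have hp : 0 < p := by linarith
  -- The dual element: `K` pairs with `svdMatrix R S h` to `∑ |h k| ^ p`. Its squared singular
  -- values carry the exponent `(2 * p - 2) / p`, complementary to `(2 - p) / p` in Hölder.
  set κ : ι → ℝ := fun k => Real.sign (h k) * |h k| ^ (p - 1) with hκ
  set K := svdMatrix R S κ with hK
  have hκ2 : ∀ k, κ k ^ 2 = (|h k| ^ p) ^ ((2 * p - 2) / p) := by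
    intro k
    rw [hκ, ← Real.rpow_mul (abs_nonneg _), mul_div_cancel₀ _ hp.ne']
    rcases eq_or_ne (h k) 0 with h0 | h0
    · simp [h0, Real.zero_rpow (by linarith : 2 * p - 2 ≠ 0)]
    · have e : (Real.sign (h k)) ^ 2 = 1 := by
        rcases Real.sign_apply_eq_of_ne_zero _ h0 with h | h <;> simp [h]
      rw [mul_pow, e, one_mul, ← Real.rpow_natCast, ← Real.rpow_mul (abs_nonneg _)]
      congr 1
      push_cast
      ring
  have hhκ : ∀ k, h k * κ k = |h k| ^ p := by
    intro k
    rcases eq_or_ne (h k) 0 with h0 | h0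
    · simp [h0, Real.zero_rpow hp.ne']
    · have e : h k * Real.sign (h k) = |h k| := by
        rcases lt_or_gt_of_ne h0 with h | h
        · rw [Real.sign_of_neg h, abs_of_neg h]; ring
        · rw [Real.sign_of_pos h, abs_of_pos h]; ring
      rw [hκ, ← mul_assoc, e, Real.rpow_sub_one (abs_ne_zero.2 h0)]
      have := abs_ne_zero.2 h0
      field_simp
  have hpow : ∀ t : ℝ, |t| ^ (2 - p) = (|t| ^ p) ^ ((2 - p) / p) := by
    intro t
    rw [← Real.rpow_mul (abs_nonneg _), mul_div_cancel₀ _ hp.ne']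
  set T := ∑ k, |h k| ^ p with hT
  have hT0 : 0 ≤ T := Finset.sum_nonneg fun k _ => by positivity
  have row : ∑ i, ∑ j, ‖K i j‖ ^ 2 * |x i| ^ (2 - p) ≤
      (∑ i, |x i| ^ p) ^ ((2 - p) / p) * T ^ ((2 * p - 2) / p) := by
    calc _ = ∑ i, ∑ k, ‖R i k‖ ^ 2 * ((|x i| ^ p) ^ ((2 - p) / p) *
          (|h k| ^ p) ^ ((2 * p - 2) / p)) := by
          refine Finset.sum_congr rfl fun i _ => ?_
          rw [← Finset.sum_mul, sum_norm_sq_svdMatrix_row hS, Finset.sum_mul]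
          refine Finset.sum_congr rfl fun k _ => ?_
          rw [hκ2, hpow]
          ring
      _ ≤ _ := doublyStochastic_holder (fun _ _ => by positivity) (sum_norm_sq_row_unitary hR)
          (sum_norm_sq_col_unitary hR) (fun _ => by positivity) (fun _ => by positivity)
          (div_nonneg (by linarith) hp.le) (div_pos (by linarith) hp) (by field_simp; ring)
  have col : ∑ i, ∑ j, ‖K i j‖ ^ 2 * |z j| ^ (2 - p) ≤
      (∑ i, |z i| ^ p) ^ ((2 - p) / p) * T ^ ((2 * p - 2) / p) := by
    rw [Finset.sum_comm]
    calc _ = ∑ i, ∑ k, ‖S i k‖ ^ 2 * ((|z i| ^ p) ^ ((2 - p) / p) *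
          (|h k| ^ p) ^ ((2 * p - 2) / p)) := by
          refine Finset.sum_congr rfl fun i _ => ?_
          rw [← Finset.sum_mul, sum_norm_sq_svdMatrix_col hR, Finset.sum_mul]
          refine Finset.sum_congr rfl fun k _ => ?_
          rw [hκ2, hpow]
          ring
      _ ≤ _ := doublyStochastic_holder (fun _ _ => by positivity) (sum_norm_sq_row_unitary hS)
          (sum_norm_sq_col_unitary hS) (fun _ => by positivity) (fun _ => by positivity)
          (div_nonneg (by linarith) hp.le) (div_pos (by linarith) hp) (by field_simp; ring)
  have hTle : T ≤ ∑ ij : ι × ι, ‖svdMatrix R S h ij.1 ij.2‖ * ‖K ij.1 ij.2‖ := by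
    have e := sum_star_svdMatrix_mul_svdMatrix hR hS h κ
    simp only [hhκ] at e
    rw [← hT, ← Fintype.sum_prod_type'] at e
    calc T = ‖(T : ℂ)‖ := by simp [abs_of_nonneg hT0]
      _ ≤ _ := by
        rw [← e]
        refine (norm_sum_le _ _).trans (le_of_eq ?_)
        simp [hK]
  have hCS : T ^ 2 ≤ (∑ i, ∑ j, q i j) * (∑ i, ∑ j, ‖K i j‖ ^ 2 *
      (|x i| ^ (2 - p) + |z j| ^ (2 - p))) := by
    rw [← Fintype.sum_prod_type' (f := q), ← Fintype.sum_prod_type'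
      (f := fun i j => ‖K i j‖ ^ 2 * (|x i| ^ (2 - p) + |z j| ^ (2 - p)))]
    refine (pow_le_pow_left₀ hT0 hTle 2).trans ?_
    refine Finset.sum_sq_le_sum_mul_sum_of_sq_le_mul _ (fun ij _ => hq0 _ _)
      (fun ij _ => by positivity) fun ij _ => ?_
    rw [mul_pow]
    calc _ ≤ (q ij.1 ij.2 * (|x ij.1| ^ (2 - p) + |z ij.2| ^ (2 - p))) * ‖K ij.1 ij.2‖ ^ 2 := by
          gcongr
          exact hq _ _
      _ = _ := by ring
  rcases hT0.eq_or_lt with h0 | h0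
  · rw [← h0, Real.zero_rpow (by positivity)]
    have : 0 ≤ ∑ i, ∑ j, q i j :=
      Finset.sum_nonneg fun i _ => Finset.sum_nonneg fun j _ => hq0 i j
    positivity
  have hTs : 0 < T ^ ((2 * p - 2) / p) := by positivity
  refine le_of_mul_le_mul_right ?_ hTs
  have e : T ^ (2 / p) * T ^ ((2 * p - 2) / p) = T ^ 2 := by
    rw [← Real.rpow_add h0, ← Real.rpow_natCast]
    congr 1
    field_simp
    push_cast
    ring
  rw [e]
  have hQ : 0 ≤ ∑ i, ∑ j, q i j :=
    Finset.sum_nonneg fun i _ => Finset.sum_nonneg fun j _ => hq0 i j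
  refine hCS.trans ?_
  rw [mul_assoc]
  refine mul_le_mul_of_nonneg_left ?_ hQ
  simp only [mul_add, Finset.sum_add_distrib]
  linarith

end Unitary

/-- Divide by the weight, which can vanish only if `x = z = 0`. -/
theorem abs_rpow_bregman_nonneg {p : ℝ} (hp1 : 1 < p) (hp2 : p ≤ 2) (x z : ℝ) :
    0 ≤ |z| ^ p - |x| ^ p - p * (Real.sign x * |x| ^ (p - 1)) * (z - x) := by
  have h := abs_rpow_bregman_mul_ge hp1 hp2 x z
  have hl : 0 ≤ p * (p - 1) / 2 * (z - x) ^ 2 := by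
    have : 0 ≤ p - 1 := by linarith
    positivity
  have hx : 0 ≤ |x| ^ (2 - p) := by positivity
  have hz : 0 ≤ |z| ^ (2 - p) := by positivity
  rcases (add_nonneg hx hz).eq_or_lt with h0 | h0
  · have hx0 : |x| ^ (2 - p) = 0 := by linarith
    have hz0 : |z| ^ (2 - p) = 0 := by linarith
    rw [Real.rpow_eq_zero_iff_of_nonneg (abs_nonneg _)] at hx0 hz0
    rw [hx0.1, hz0.1, abs_eq_zero.1 hx0.1]
    simp
  · exact nonneg_of_mul_nonneg_left (hl.trans h) h0

/-! ### Hermitian matrices and dilation -/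

section Hermitian
variable {ι : Type*} [Fintype ι] [DecidableEq ι]

/-- The trace of `|M| ^ p` for a Hermitian matrix `M`. -/
noncomputable def absPowTrace {M : Matrix ι ι ℂ} (hM : M.IsHermitian) (p : ℝ) : ℝ :=
  ∑ i, |hM.eigenvalues i| ^ p

theorem Matrix.IsHermitian.eq_svdMatrix {M : Matrix ι ι ℂ} (hM : M.IsHermitian) :
    M = svdMatrix (hM.eigenvectorUnitary : Matrix ι ι ℂ) hM.eigenvectorUnitary hM.eigenvalues := by
  conv_lhs => rw [hM.spectral_theorem, Unitary.conjStarAlgAut_apply]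
  rfl

theorem svdMatrix_conj (U V R S : Matrix ι ι ℂ) (κ : ι → ℝ) :
    Uᴴ * svdMatrix R S κ * V = svdMatrix (Uᴴ * R) (Vᴴ * S) κ := by
  simp only [svdMatrix, conjTranspose_mul, conjTranspose_conjTranspose, mul_assoc]

/-- A strong form of Klein's inequality: strong convexity of `M ↦ Tr |M| ^ p` on Hermitian
matrices. -/
theorem absPowTrace_strongConvex {X Y : Matrix ι ι ℂ} (hX : X.IsHermitian) (hY : Y.IsHermitian)
    {p : ℝ} (hp1 : 1 < p) (hp2 : p ≤ 2) :
    ∃ l : ℝ, ∀ (ξ : ℝ) (Z : Matrix ι ι ℂ) (hZ : Z.IsHermitian), Z = X + (ξ : ℂ) • Y →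
      0 ≤ absPowTrace hZ p - absPowTrace hX p - p * ξ * l ∧
      p * (p - 1) / 2 * ξ ^ 2 * absPowTrace hY p ^ (2 / p) ≤
        (absPowTrace hZ p - absPowTrace hX p - p * ξ * l) *
          (absPowTrace hX p ^ ((2 - p) / p) + absPowTrace hZ p ^ ((2 - p) / p)) := by
  have hp : 0 < p := by linarith
  have hpp : 0 < p * (p - 1) / 2 := by
    have : 0 < p - 1 := by linarith
    positivity
  set U : Matrix ι ι ℂ := (hX.eigenvectorUnitary : Matrix ι ι ℂ) with hU
  have hUm : U ∈ unitaryGroup ι ℂ := hX.eigenvectorUnitary.2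
  set x := hX.eigenvalues with hx
  set g : ℝ → ℝ := fun t => Real.sign t * |t| ^ (p - 1) with hg
  -- `p * l` plays the role of the derivative of the trace functional at `X` along `Y`; it is
  -- independent of `ξ`, as the later cancellation requires.
  refine ⟨∑ i, g (x i) * ((Uᴴ * Y * U) i i).re, fun ξ Z hZ hZeq => ?_⟩
  set l := ∑ i, g (x i) * ((Uᴴ * Y * U) i i).re with hl
  set V : Matrix ι ι ℂ := (hZ.eigenvectorUnitary : Matrix ι ι ℂ) with hV
  have hVm : V ∈ unitaryGroup ι ℂ := hZ.eigenvectorUnitary.2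
  set z := hZ.eigenvalues with hz
  set E : Matrix ι ι ℂ := (hY.eigenvectorUnitary : Matrix ι ι ℂ) with hE
  have hEm : E ∈ unitaryGroup ι ℂ := hY.eigenvectorUnitary.2
  set h := hY.eigenvalues with hh
  have hXe : X = svdMatrix U U x := hX.eq_svdMatrix
  have hZe : Z = svdMatrix V V z := hZ.eq_svdMatrix
  have hYe : Y = svdMatrix E E h := hY.eq_svdMatrix
  have hUU : Uᴴ * U = 1 := mem_unitaryGroup_iff'.1 hUm
  have hVV : Vᴴ * V = 1 := mem_unitaryGroup_iff'.1 hVm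
  have hUm' : Uᴴ ∈ unitaryGroup ι ℂ := Unitary.star_mem hUm
  have hVm' : Vᴴ ∈ unitaryGroup ι ℂ := Unitary.star_mem hVm
  set W := Uᴴ * V with hW
  have hWm : W ∈ unitaryGroup ι ℂ := mul_mem hUm' hVm
  have hRm : Uᴴ * E ∈ unitaryGroup ι ℂ := mul_mem hUm' hEm
  have hSm : Vᴴ * E ∈ unitaryGroup ι ℂ := mul_mem hVm' hEm
  have entry : ∀ i j, svdMatrix (Uᴴ * E) (Vᴴ * E) (fun k => ξ * h k) i j =
      ((z j - x i : ℝ) : ℂ) * W i j := by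
    intro i j
    have e1 : svdMatrix E E (fun k => ξ * h k) = (ξ : ℂ) • Y := by
      rw [hYe, svdMatrix, svdMatrix, ← Matrix.smul_mul, ← Matrix.mul_smul, ← diagonal_smul]
      congr 3
      ext k
      simp
    have e2 : (ξ : ℂ) • Y = Z - X := by rw [hZeq]; abel
    have e3 : Uᴴ * Z * V = W * diagonal (fun k => (z k : ℂ)) := by
      rw [hZe, svdMatrix_conj, hVV, svdMatrix, conjTranspose_one, mul_one]
    have e4 : Uᴴ * X * V = diagonal (fun k => (x k : ℂ)) * W := by
      rw [hXe, svdMatrix_conj, hUU, svdMatrix, one_mul, conjTranspose_mul,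
        conjTranspose_conjTranspose]
    rw [← svdMatrix_conj, e1, e2, mul_sub, sub_mul, e3, e4, Matrix.sub_apply, mul_diagonal,
      diagonal_mul]
    push_cast
    ring
  have rowz : ∀ i, ∑ j, ‖W i j‖ ^ 2 * z j = x i + ξ * ((Uᴴ * Y * U) i i).re := by
    intro i
    have e1 : Uᴴ * Z * U = svdMatrix W W z := by
      rw [hZe, svdMatrix_conj]
    have e2 : Uᴴ * Z * U = diagonal (fun k => (x k : ℂ)) + (ξ : ℂ) • (Uᴴ * Y * U) := by
      rw [hZeq, mul_add, add_mul, Matrix.mul_smul, Matrix.smul_mul]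
      congr 1
      rw [hXe, svdMatrix_conj, hUU]
      simp [svdMatrix]
    have e3 := congrArg Complex.re (svdMatrix_self_apply_self W z i)
    rw [Complex.ofReal_re, ← e1, e2] at e3
    rw [← e3]
    simp
  set q : ι → ι → ℝ := fun i j =>
    ‖W i j‖ ^ 2 * (|z j| ^ p - |x i| ^ p - p * g (x i) * (z j - x i)) with hq
  have hq0 : ∀ i j, 0 ≤ q i j := fun i j =>
    mul_nonneg (by positivity) (abs_rpow_bregman_nonneg hp1 hp2 _ _)
  have hsum : ∑ i, ∑ j, q i j = absPowTrace hZ p - absPowTrace hX p - p * ξ * l := by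
    have e1 : ∀ i, ∑ j, q i j = ∑ j, ‖W i j‖ ^ 2 * |z j| ^ p - |x i| ^ p
        - p * ξ * (g (x i) * ((Uᴴ * Y * U) i i).re) := by
      intro i
      have e : ∀ j, q i j = ‖W i j‖ ^ 2 * |z j| ^ p - ‖W i j‖ ^ 2 * |x i| ^ p -
          p * g (x i) * (‖W i j‖ ^ 2 * z j) + ‖W i j‖ ^ 2 * (p * g (x i) * x i) := by
        intro j
        simp only [hq]
        ring
      simp only [e, Finset.sum_add_distrib, Finset.sum_sub_distrib, ← Finset.sum_mul,
        ← Finset.mul_sum, rowz, sum_norm_sq_row_unitary hWm]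
      ring
    simp only [e1, Finset.sum_sub_distrib, ← Finset.mul_sum]
    rw [Finset.sum_comm]
    simp only [← Finset.sum_mul, sum_norm_sq_col_unitary hWm, one_mul]
    rfl
  refine ⟨hsum ▸ Finset.sum_nonneg fun i _ => Finset.sum_nonneg fun j _ => hq0 i j, ?_⟩
  have key := svdMatrix_weighted_bound hRm hSm hp1 hp2 x z (fun k => ξ * h k)
    (q := fun i j => (p * (p - 1) / 2)⁻¹ * q i j)
    (fun i j => mul_nonneg (inv_nonneg.2 hpp.le) (hq0 i j)) (by
      intro i j
      have hb := mul_le_mul_of_nonneg_left (abs_rpow_bregman_mul_ge hp1 hp2 (x i) (z j))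
        (by positivity : 0 ≤ ‖W i j‖ ^ 2)
      rw [entry, norm_mul, Complex.norm_real, mul_pow, Real.norm_eq_abs, sq_abs]
      rw [mul_assoc (p * (p - 1) / 2)⁻¹, le_inv_mul_iff₀ hpp]
      refine le_trans (le_of_eq ?_) (hb.trans (le_of_eq ?_))
      · ring
      · simp only [hq, hg]
        ring)
  simp only [← Finset.mul_sum, hsum] at key
  have eh : (∑ k, |ξ * h k| ^ p) ^ (2 / p) = ξ ^ 2 * absPowTrace hY p ^ (2 / p) := by
    simp only [abs_mul, Real.mul_rpow (abs_nonneg _) (abs_nonneg _), ← Finset.mul_sum]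
    rw [Real.mul_rpow (by positivity) (Finset.sum_nonneg fun k _ => by positivity),
      ← Real.rpow_mul (abs_nonneg _), mul_div_cancel₀ _ hp.ne', Real.rpow_two, sq_abs]
    rfl
  rw [eh, mul_assoc (p * (p - 1) / 2)⁻¹, le_inv_mul_iff₀ hpp] at key
  rw [mul_assoc (p * (p - 1) / 2)]
  exact key

/-- The Hermitian dilation of a square matrix. -/
def hermitianDilation (A : Matrix ι ι ℂ) : Matrix (ι ⊕ ι) (ι ⊕ ι) ℂ :=
  fromBlocks 0 A Aᴴ 0

omit [Fintype ι] [DecidableEq ι] in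
theorem isHermitian_hermitianDilation (A : Matrix ι ι ℂ) : (hermitianDilation A).IsHermitian := by
  simp [hermitianDilation, IsHermitian, fromBlocks_conjTranspose]

omit [Fintype ι] [DecidableEq ι] in
theorem hermitianDilation_add_smul (A B : Matrix ι ι ℂ) (ξ : ℝ) :
    hermitianDilation (A + (ξ : ℂ) • B) =
      hermitianDilation A + (ξ : ℂ) • hermitianDilation B := by
  simp [hermitianDilation, fromBlocks_smul, fromBlocks_add]

/-- Expressing spectral sums through characteristic polynomials avoids matching eigenvalue
enumerations of different matrices. -/
theorem Matrix.IsHermitian.sum_eigenvalues_eq {M : Matrix ι ι ℂ} (hM : M.IsHermitian) (φ : ℝ → ℝ) :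
    ∑ i, φ (hM.eigenvalues i) = (M.charpoly.roots.map fun w => φ w.re).sum := by
  rw [hM.roots_charpoly_eq_eigenvalues, Multiset.map_map]
  simp

theorem Matrix.IsHermitian.sum_eigenvalues_sq_eq {M : Matrix ι ι ℂ} (hM : M.IsHermitian)
    (φ : ℝ → ℝ) :
    ∑ i, φ (hM.eigenvalues i ^ 2) = ((M * M).charpoly.roots.map fun w => φ w.re).sum := by
  have hU : (hM.eigenvectorUnitary : Matrix ι ι ℂ) ∈ unitaryGroup ι ℂ := hM.eigenvectorUnitary.2
  have e : (M * M).charpoly =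
      ∏ i, (Polynomial.X - Polynomial.C ((hM.eigenvalues i ^ 2 : ℝ) : ℂ)) := by
    conv_lhs => rw [hM.eq_svdMatrix]
    rw [svdMatrix_mul_svdMatrix hU, svdMatrix, mul_assoc, charpoly_mul_comm, mul_assoc,
      ← star_eq_conjTranspose, mem_unitaryGroup_iff'.1 hU, mul_one, charpoly_diagonal]
    simp [sq]
  rw [e, Polynomial.roots_prod]
  · simp only [Polynomial.roots_X_sub_C, Multiset.bind_singleton, Multiset.map_map,
      Function.comp_def, Complex.ofReal_re]
    rfl
  · simp only [ne_eq, Finset.prod_eq_zero_iff, not_exists, not_and]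
    exact fun i _ => Polynomial.X_sub_C_ne_zero _

theorem hermitianDilation_mul_self (A : Matrix ι ι ℂ) :
    hermitianDilation A * hermitianDilation A = fromBlocks (A * Aᴴ) 0 0 (Aᴴ * A) := by
  simp [hermitianDilation, fromBlocks_multiply]

/-- The squared dilation has diagonal blocks `A * Aᴴ` and `Aᴴ * A`, whose characteristic polynomials
agree, so every singular value counts twice. -/
theorem absPowTrace_hermitianDilation {n : ℕ} (A : Matrix (Fin n) (Fin n) ℂ) (p : ℝ) :
    absPowTrace (isHermitian_hermitianDilation A) p = 2 * ∑ i, matSingularValue A i ^ p := by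
  have h1 := (isHermitian_hermitianDilation A).sum_eigenvalues_sq_eq fun t => Real.sqrt t ^ p
  have h2 := (isHermitian_conjTranspose_mul_self A).sum_eigenvalues_eq fun t => Real.sqrt t ^ p
  simp only [Real.sqrt_sq_eq_abs] at h1
  rw [absPowTrace, h1, hermitianDilation_mul_self, charpoly_fromBlocks_zero₁₂,
    charpoly_mul_comm A, Polynomial.roots_mul (mul_ne_zero (charpoly_monic _).ne_zero
      (charpoly_monic _).ne_zero), Multiset.map_add, Multiset.sum_add, ← h2, two_mul]
  rfl

end Hermitian

theorem sum_matSingularValue_rpow_nonneg {n : ℕ} (p : ℝ) (A : Matrix (Fin n) (Fin n) ℂ) :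
    0 ≤ ∑ i, matSingularValue A i ^ p :=
  Finset.sum_nonneg fun _ _ => Real.rpow_nonneg (Real.sqrt_nonneg _) _

theorem schattenNorm_nonneg {n : ℕ} (p : ℝ) (A : Matrix (Fin n) (Fin n) ℂ) :
    0 ≤ schattenNorm p A :=
  Real.rpow_nonneg (sum_matSingularValue_rpow_nonneg p A) _

theorem schattenNorm_rpow {n : ℕ} {p : ℝ} (hp : 0 < p) (t : ℝ) (A : Matrix (Fin n) (Fin n) ℂ) :
    schattenNorm p A ^ t = (∑ i, matSingularValue A i ^ p) ^ (t / p) := by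
  rw [schattenNorm, ← Real.rpow_mul (sum_matSingularValue_rpow_nonneg p A)]
  congr 1
  field_simp

/-- Strong convexity of the `p`-th power of the Schatten `p`-norm along a line. -/
theorem schattenNorm_strongConvex {n : ℕ} (A B : Matrix (Fin n) (Fin n) ℂ) {p : ℝ} (hp1 : 1 < p)
    (hp2 : p ≤ 2) :
    ∃ l : ℝ, ∀ ξ : ℝ,
      0 ≤ schattenNorm p (A + (ξ : ℂ) • B) ^ p - schattenNorm p A ^ p - ξ * l ∧
      p * (p - 1) / 2 * (ξ ^ 2 * schattenNorm p B ^ 2) ≤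
        (schattenNorm p (A + (ξ : ℂ) • B) ^ p - schattenNorm p A ^ p - ξ * l) *
          (schattenNorm p A ^ (2 - p) + schattenNorm p (A + (ξ : ℂ) • B) ^ (2 - p)) := by
  have hp : 0 < p := by linarith
  obtain ⟨l, hl⟩ := absPowTrace_strongConvex (isHermitian_hermitianDilation A)
    (isHermitian_hermitianDilation B) hp1 hp2
  refine ⟨p * l / 2, fun ξ => ?_⟩
  obtain ⟨h1, h2⟩ := hl ξ _ (isHermitian_hermitianDilation (A + (ξ : ℂ) • B))
    (hermitianDilation_add_smul A B ξ)
  simp only [absPowTrace_hermitianDilation, Real.mul_rpow zero_le_two (sum_matSingularValue_rpow_nonneg p _),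
    ← schattenNorm_rpow hp] at h1 h2
  have e : ∀ M : Matrix (Fin n) (Fin n) ℂ, ∑ i, matSingularValue M i ^ p = schattenNorm p M ^ p := by
    intro M
    rw [schattenNorm_rpow hp, div_self hp.ne', Real.rpow_one]
  -- The doubling by dilation contributes the same power of two to both sides.
  have e2 : (2 : ℝ) ^ (2 / p) = 2 * 2 ^ ((2 - p) / p) := by
    rw [sub_div, div_self hp.ne', Real.rpow_sub_one two_ne_zero]
    ring
  simp only [e, e2, Real.rpow_two] at h1 h2
  refine ⟨by linarith, ?_⟩
  have hk : (0 : ℝ) < 2 * 2 ^ ((2 - p) / p) := by positivity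
  refine le_of_mul_le_mul_left ?_ hk
  refine le_trans (le_of_eq ?_) (h2.trans (le_of_eq ?_)) <;> ring

/-! ### From two points to squares -/

/-- After expansion, `a ^ p * b ^ (2 - p) ≥ a ^ 2`, and AM-GM bounds `b ^ p * a ^ (2 - p)`. -/
theorem rpow_sub_mul_le_sq_sub {p a b : ℝ} (hp1 : 1 < p) (hp2 : p ≤ 2) (ha : 0 ≤ a) (hab : a ≤ b) :
    (b ^ p - a ^ p) * (a ^ (2 - p) + b ^ (2 - p)) ≤ (p + 2) / 2 * (b ^ 2 - a ^ 2) := by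
  have hb := ha.trans hab
  have ea := rpow_mul_rpow_two_sub (p := p) ha
  have eb := rpow_mul_rpow_two_sub (p := p) hb
  have h1 : a ^ p * a ^ (2 - p) ≤ a ^ p * b ^ (2 - p) := by
    have : a ^ (2 - p) ≤ b ^ (2 - p) := Real.rpow_le_rpow ha hab (by linarith)
    gcongr
  have h2 := Real.geom_mean_le_arith_mean2_weighted (w₁ := (2 - p) / 2) (w₂ := p / 2)
    (p₁ := a ^ (2 : ℝ)) (p₂ := b ^ (2 : ℝ)) (by linarith) (by linarith) (by positivity)
    (by positivity) (by ring)
  rw [← Real.rpow_mul ha, ← Real.rpow_mul hb, mul_div_cancel₀ _ two_ne_zero,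
    mul_div_cancel₀ _ two_ne_zero, Real.rpow_two, Real.rpow_two] at h2
  nlinarith

/-- Cauchy–Schwarz with `q ≥ c ξ ^ 2 / y`, kept free of division because `y` may vanish. -/
theorem cauchy_schwarz_two {l₁ l₂ ξ₁ ξ₂ q₁ q₂ y₁ y₂ c : ℝ} (hl₁ : 0 ≤ l₁) (hl₂ : 0 ≤ l₂)
    (hq₁ : 0 ≤ q₁) (hq₂ : 0 ≤ q₂) (hy₁ : 0 ≤ y₁) (hy₂ : 0 ≤ y₂) (hc : 0 ≤ c)
    (h₁ : c * ξ₁ ^ 2 ≤ q₁ * y₁) (h₂ : c * ξ₂ ^ 2 ≤ q₂ * y₂)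
    (hξ : l₁ * ξ₁ ^ 2 + l₂ * ξ₂ ^ 2 = 1) :
    c ≤ (l₁ * q₁ + l₂ * q₂) * (l₁ * ξ₁ ^ 2 * y₁ + l₂ * ξ₂ ^ 2 * y₂) := by
  have hcross : 2 * (c * ξ₁ ^ 2 * ξ₂ ^ 2) ≤ q₁ * y₂ * ξ₂ ^ 2 + q₂ * y₁ * ξ₁ ^ 2 := by
    refine abs_le_of_sq_le_sq' ?_ (by positivity) |>.2
    have h3 : (c * ξ₁ ^ 2) * (c * ξ₂ ^ 2) ≤ (q₁ * y₁) * (q₂ * y₂) :=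
      mul_le_mul h₁ h₂ (by positivity) (by positivity)
    have h4 := mul_le_mul_of_nonneg_right h3 (by positivity : 0 ≤ ξ₁ ^ 2 * ξ₂ ^ 2)
    nlinarith [sq_nonneg (q₁ * y₂ * ξ₂ ^ 2 - q₂ * y₁ * ξ₁ ^ 2)]
  have hA := mul_le_mul_of_nonneg_left h₁ (by positivity : 0 ≤ l₁ ^ 2 * ξ₁ ^ 2)
  have hB := mul_le_mul_of_nonneg_left h₂ (by positivity : 0 ≤ l₂ ^ 2 * ξ₂ ^ 2)
  have hC := mul_le_mul_of_nonneg_left hcross (by positivity : 0 ≤ l₁ * l₂)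
  have e : c = c * (l₁ * ξ₁ ^ 2 + l₂ * ξ₂ ^ 2) ^ 2 := by rw [hξ]; ring
  rw [e]
  nlinarith

/-- The argument yields the exponent `4 - 8 / p`; both branches are weaker, by `p ≥ 1` and `p ≤ 2`
respectively. -/
theorem asymConvexityConst_le {p μ : ℝ} (hp1 : 1 < p) (hp2 : p ≤ 2) (hμ : 1 ≤ μ) :
    asymConvexityConst p μ ≤ 1 / 3 * μ ^ (4 - 8 / p) := by
  have hp : 0 < p := by linarith
  rw [asymConvexityConst]
  split_ifs with h
  · refine mul_le_mul_of_nonneg_left (Real.rpow_le_rpow_of_exponent_le hμ ?_) (by norm_num)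
    have : 8 / p ≤ 8 := by rw [div_le_iff₀ hp]; linarith
    linarith
  · refine mul_le_mul_of_nonneg_left (Real.rpow_le_rpow_of_exponent_le hμ ?_) (by norm_num)
    have : 4 ≤ 8 / p := by rw [le_div_iff₀ hp]; linarith
    have e : 16 / p = 2 * (8 / p) := by ring
    linarith

/-- The passage from strong convexity of `p`-th powers along the two points `μ ^ 2` and `-μ ^ (-2)`
to the inequality for squares. -/
theorem sq_add_mul_sq_le_of_two_points {p μ lam a b₁ b₂ h l : ℝ} (hp1 : 1 < p) (hp2 : p ≤ 2)
    (hμ : 1 ≤ μ) (hlam : lam = 1 / (1 + μ ^ 4)) (ha0 : 0 ≤ a) (hb₁0 : 0 ≤ b₁) (hb₂0 : 0 ≤ b₂)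
    (hq₁ : 0 ≤ b₁ ^ p - a ^ p - μ ^ 2 * l) (hq₂ : 0 ≤ b₂ ^ p - a ^ p - -(μ ^ 2)⁻¹ * l)
    (h₁ : p * (p - 1) / 2 * ((μ ^ 2) ^ 2 * h ^ 2) ≤
      (b₁ ^ p - a ^ p - μ ^ 2 * l) * (a ^ (2 - p) + b₁ ^ (2 - p)))
    (h₂ : p * (p - 1) / 2 * ((-(μ ^ 2)⁻¹) ^ 2 * h ^ 2) ≤
      (b₂ ^ p - a ^ p - -(μ ^ 2)⁻¹ * l) * (a ^ (2 - p) + b₂ ^ (2 - p))) :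
    a ^ 2 + asymConvexityConst p μ * (p - 1) * h ^ 2 ≤
      (lam * b₁ ^ p + (1 - lam) * b₂ ^ p) ^ (2 / p) := by
  have hp : 0 < p := by linarith
  have hμ0 : 0 < μ := by linarith
  have hlam0 : 0 < lam := by rw [hlam]; positivity
  have hlam1 : 1 - lam = μ ^ 4 * lam := by rw [hlam]; field_simp; ring
  have hlam1' : 0 < 1 - lam := by rw [hlam1]; positivity
  -- Multiplying by the squared points swaps the weights `lam` and `1 - lam`.
  have hρ : lam * (μ ^ 2) ^ 2 + (1 - lam) * (-(μ ^ 2)⁻¹) ^ 2 = 1 := by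
    rw [hlam1]
    have : lam * (1 + μ ^ 4) = 1 := by rw [hlam]; field_simp
    field_simp
    linarith
  obtain ⟨P, hP⟩ : ∃ P, P = lam * b₁ ^ p + (1 - lam) * b₂ ^ p := ⟨_, rfl⟩
  rw [← hP]
  have hP0 : 0 ≤ P := by rw [hP]; positivity
  obtain ⟨β, hβ⟩ : ∃ β, β = P ^ (1 / p) := ⟨_, rfl⟩
  have hβ0 : 0 ≤ β := by rw [hβ]; positivity
  have hβp : β ^ p = P := by
    rw [hβ, ← Real.rpow_mul hP0, one_div, inv_mul_cancel₀ hp.ne', Real.rpow_one]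
  have hβ2 : P ^ (2 / p) = β ^ 2 := by
    rw [hβ, ← Real.rpow_natCast, ← Real.rpow_mul hP0]
    congr 1
    push_cast
    ring
  have hT : lam * (b₁ ^ p - a ^ p - μ ^ 2 * l) + (1 - lam) * (b₂ ^ p - a ^ p - -(μ ^ 2)⁻¹ * l) =
      β ^ p - a ^ p := by
    rw [hβp, hP, hlam1]
    have : 1 - lam = μ ^ 4 * lam := hlam1
    field_simp
    linear_combination a ^ p * this
  have hT0 : 0 ≤ β ^ p - a ^ p := by rw [← hT]; positivity
  have haβ : a ≤ β := by
    rw [← Real.rpow_le_rpow_iff ha0 hβ0 hp]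
    linarith
  have hpp : 0 ≤ p * (p - 1) / 2 := by
    have : 0 ≤ p - 1 := by linarith
    positivity
  have hCS := cauchy_schwarz_two (c := p * (p - 1) / 2 * h ^ 2)
    (y₁ := a ^ (2 - p) + b₁ ^ (2 - p)) (y₂ := a ^ (2 - p) + b₂ ^ (2 - p)) hlam0.le hlam1'.le hq₁ hq₂
    (by positivity) (by positivity) (by positivity) (by linarith only [h₁]) (by linarith only [h₂]) hρ
  rw [hT] at hCS
  have hr : 0 ≤ (2 - p) / p := div_nonneg (by linarith) hp.le
  -- Jensen for the concave power `(2 - p) / p` under the swapped weights, each at most `μ ^ 4`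
  -- times the original one.
  have hJ : lam * (μ ^ 2) ^ 2 * b₁ ^ (2 - p) + (1 - lam) * (-(μ ^ 2)⁻¹) ^ 2 * b₂ ^ (2 - p) ≤
      μ ^ (4 * ((2 - p) / p)) * β ^ (2 - p) := by
    have hc := (Real.concaveOn_rpow hr (by rw [div_le_one hp]; linarith)).2
      (Set.mem_Ici.2 (Real.rpow_nonneg hb₁0 p)) (Set.mem_Ici.2 (Real.rpow_nonneg hb₂0 p))
      (by positivity : 0 ≤ lam * (μ ^ 2) ^ 2)
      (by positivity : 0 ≤ (1 - lam) * (-(μ ^ 2)⁻¹) ^ 2) hρ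
    simp only [smul_eq_mul] at hc
    rw [← Real.rpow_mul hb₁0, ← Real.rpow_mul hb₂0, mul_div_cancel₀ _ hp.ne'] at hc
    refine hc.trans ?_
    have e : μ ^ (4 * ((2 - p) / p)) * β ^ (2 - p) = (μ ^ 4 * P) ^ ((2 - p) / p) := by
      rw [Real.mul_rpow (by positivity) hP0, Real.rpow_mul hμ0.le, ← hβp, ← Real.rpow_mul hβ0,
        mul_div_cancel₀ _ hp.ne']
      norm_cast
    rw [e]
    refine Real.rpow_le_rpow (by positivity) ?_ hr
    have hm : (-(μ ^ 2)⁻¹) ^ 2 ≤ μ ^ 4 := by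
      have h1 : (μ ^ 2)⁻¹ ≤ 1 := inv_le_one_of_one_le₀ (one_le_pow₀ hμ)
      have h2 : 1 ≤ μ ^ 4 := one_le_pow₀ hμ
      have h3 : 0 < (μ ^ 2)⁻¹ := by positivity
      nlinarith
    have := mul_le_mul_of_nonneg_right hm (by positivity : 0 ≤ (1 - lam) * b₂ ^ p)
    rw [hP]
    linarith only [this]
  have hM1 : 1 ≤ μ ^ (4 * ((2 - p) / p)) := Real.one_le_rpow hμ (by positivity)
  set M := μ ^ (4 * ((2 - p) / p)) with hM
  have hfin : p * (p - 1) / 2 * h ^ 2 ≤ (β ^ p - a ^ p) * (M * (a ^ (2 - p) + β ^ (2 - p))) := by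
    refine hCS.trans (mul_le_mul_of_nonneg_left ?_ hT0)
    have h3 : 0 ≤ a ^ (2 - p) := by positivity
    have h4 : a ^ (2 - p) = (lam * (μ ^ 2) ^ 2 + (1 - lam) * (-(μ ^ 2)⁻¹) ^ 2) * a ^ (2 - p) := by
      rw [hρ, one_mul]
    have h5 := mul_le_mul_of_nonneg_right hM1 h3
    linarith only [h4, h5, hJ]
  have hsq := rpow_sub_mul_le_sq_sub hp1 hp2 ha0 haβ
  have hfin2 : p * (p - 1) / 2 * h ^ 2 ≤ M * ((p + 2) / 2 * (β ^ 2 - a ^ 2)) := by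
    have := mul_le_mul_of_nonneg_left hsq (by linarith : 0 ≤ M)
    linarith
  have hC : asymConvexityConst p μ * M ≤ 1 / 3 := by
    have h1 := mul_le_mul_of_nonneg_right (asymConvexityConst_le hp1 hp2 hμ) (by linarith : 0 ≤ M)
    have h2 : μ ^ (4 - 8 / p) * M = 1 := by
      rw [hM, ← Real.rpow_add hμ0]
      convert Real.rpow_zero μ using 2
      field_simp
      ring
    linarith
  rw [hβ2]
  have hMpos : 0 < M := by linarith
  have hh2 : 0 ≤ (p - 1) * h ^ 2 := mul_nonneg (by linarith) (by positivity)
  have hC2 := mul_le_mul_of_nonneg_right hC hh2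
  have hfin3 : (p - 1) * h ^ 2 / 3 ≤ M * (β ^ 2 - a ^ 2) := by
    have : p * ((p - 1) * h ^ 2) ≤ (p + 2) * (M * (β ^ 2 - a ^ 2)) := by
      linarith only [hfin2]
    -- The constant `1 / 3` is the lower bound of `p / (p + 2)` for `p ≥ 1`.
    have h3 : (p + 2) * ((p - 1) * h ^ 2 / 3) ≤ p * ((p - 1) * h ^ 2) := by
      linarith only [mul_le_mul_of_nonneg_right (by linarith : (p + 2) / 3 ≤ p) hh2]
    exact le_of_mul_le_mul_left (h3.trans this) (by linarith)
  have : M * (asymConvexityConst p μ * (p - 1) * h ^ 2) ≤ M * (β ^ 2 - a ^ 2) := by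
    linarith only [hC2, hfin3]
  have := le_of_mul_le_mul_left this hMpos
  linarith

theorem mainTheorem6 (p μ lam : ℝ) (hp1 : 1 < p) (hp2 : p ≤ 2) (hμ : 1 ≤ μ)
    (hlam : lam = 1 / (1 + μ ^ 4)) (n : ℕ) (A B : Matrix (Fin n) (Fin n) ℂ) :
    schattenNorm p A ^ 2 + asymConvexityConst p μ * (p - 1) * schattenNorm p B ^ 2 ≤
      (lam * schattenNorm p (A + ((μ ^ 2 : ℝ) : ℂ) • B) ^ p +
        (1 - lam) * schattenNorm p (A - (((μ ^ 2)⁻¹ : ℝ) : ℂ) • B) ^ p) ^ (2 / p) := by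
  obtain ⟨l, hl⟩ := schattenNorm_strongConvex A B hp1 hp2
  obtain ⟨hq₁, h₁⟩ := hl (μ ^ 2)
  obtain ⟨hq₂, h₂⟩ := hl (-(μ ^ 2)⁻¹)
  have hsub : A + ((-(μ ^ 2)⁻¹ : ℝ) : ℂ) • B = A - (((μ ^ 2)⁻¹ : ℝ) : ℂ) • B := by
    rw [Complex.ofReal_neg, neg_smul, sub_eq_add_neg]
  rw [hsub] at hq₂ h₂
  exact sq_add_mul_sq_le_of_two_points hp1 hp2 hμ hlam (schattenNorm_nonneg _ _)
    (schattenNorm_nonneg _ _) (schattenNorm_nonneg _ _) hq₁ hq₂ h₁ h₂
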